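/- **Model.** Non-uniform algorithms are layered Boolean circuits of fan-in two; the depth is the parallel running time, the maximal number of gates in a layer (width) is the number of processors, and the number of gates (size) is the total running time. Randomized algorithms receive uniform coins as extra input. A function is negligible if it is $\lambda^{-\omega(1)}$. **Relaxed sink of verifiable line.** An rSVL instance $(S,V,v,T)$ on $\{0,1\}^\lambda$ consists of $T\in\{1,\dots,2^\lambda\}$, a source $v\in\{0,1\}^\lambda$, and $S:\{0,1\}^\lambda\to\{0,1\}^\lambda$, $V:\{0,1\}^\lambda\times\{1,\dots,T\}\to\{0,1\}$ such that $V(S^i(v),i)=1$ for all $1\le i\le T$. A false positive is a pair $(u,i)$, $1\le i\le T$, with $V(u,i)=1$ and $u\ne S^i(v)$; $u$ is then called a false positive vertex. A solution is a pair $(u,T)$ with $V(u,T)=1$, or a false positive. A family of rSVL instances with delay $T=T(\lambda)$ consists, for each $\lambda$, of sub-families $\{(S_k,V_{k,v},v,T(\lambda))\}_{v\in\{0,1\}^\lambda}$ indexed by keys $k$ of $\mathrm{poly}(\lambda)$ bits, where $S_k(u)$ and $V_{k,v}(u,i)$ are computed by $\mathrm{poly}(\lambda)$-size circuits from $(k,u)$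 and $(k,v,u,i)$. **Verifiable delay functions.** A VDF consists of a randomized $\mathsf{Setup}\to pp$, $\mathsf{Eval}(pp,x)\to(y,\pi)$, whose output $y$ is deterministic, and a deterministic $\mathsf{Verify}(pp,x,y,\pi)\in\{0,1\}$; $\mathsf{Setup}$ and $\mathsf{Verify}$ run in time $\mathrm{poly}(\lambda,\log T)$. It is a permutation VDF if inputs and outputs range over the same set. It is *correct* if for random $pp$ and $x$ the honest $(y,\pi)$ is accepted with probability at least $1-\mathrm{negl}(\lambda)$. It is *sound* if every non-uniform algorithm of running time $\mathrm{poly}(\lambda,T)$, given $pp$, outputs some accepted $(x,y,\pi)$ with $y\neq\mathsf{Eval}(pp,x)$ only with negligible probability. It is *$(\Delta,\sigma)$-sequential* if every pair of non-uniform randomized algorithms, where the first computes a state from $pp$ in time $\mathrm{poly}(\lambda,T)$, and the second, on at most $\Delta$ processors in parallel time $\sigma$, computes from the state and a uniformly random $x$ a string, outputs $\mathsf{Eval}(pp,x)$ only with negligible probability. **Theorem.** Let $T=T(\lambda)\in 2^{o(\lambda)}$, and let a family of rSVL instances with delay $T$ be given, in which each instance has at most $\mathrm{poly}(\lambda)$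 false positive vertices. Then there is a permutation VDF on $\{0,1\}^\lambda$ with delay parameter $T$ such that $\mathsf{Setup}$ samples a key $pp=k$ uniformly at random, $\mathsf{Eval}(pp,x)=S_k^{T}(x)$ with empty proof, and $\mathsf{Verify}(pp,x,y)=V_{k,x}(y,T)$. $\mathsf{Eval}$ runs in parallel time $T$, measured in units of one evaluation of $S$ (a unit is the larger of $1$ and the depth of the circuit for $S$), on $\mathrm{poly}(\lambda,\log T)$ processors. Moreover: 1. (Correctness.) The VDF is correct; in fact $\mathsf{Verify}(pp,x,\mathsf{Eval}(pp,x))=1$ for all $pp$ and $x$. There is a negligible $\varepsilon$ such that for all $pp$ and $x$, a uniformly random $y$ satisfies $y\ne\mathsf{Eval}(pp,x)$ and $\mathsf{Verify}(pp,x,y)=1$ with probability at most $\varepsilon(\lambda)$. 2. (Soundness.) For every adversary $\mathcal A$ against soundness there is an algorithm $\mathcal B$, of size larger by at most $3\lambda+1$ and depth larger by at most $1$, that on a random key $k$ outputs a source $v$ together with a false positive of $(S_k,V_{k,v},v,T)$ with exactly the probability with which $\mathcal A$ breaks soundness. Hence, if no non-uniform algorithm of running time $\mathrm{poly}(\lambda,T)$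 finds false positives in this way with non-negligible probability, the VDF is sound. 3. (Sequentiality.) For every pair of algorithms $\mathcal A$ that computes $\mathsf{Eval}(pp,x)$ for random $pp$ and $x$ in parallel time $T_{\mathcal A}$ on $p$ processors with probability $\epsilon$, there is a pair $\mathcal B$ with no larger precomputation that solves the rSVL instance with random key and random source in parallel time $T_{\mathcal A}+1$ on $\max(p,2\lambda+1)$ processors with probability at least $\epsilon$. Hence, for all $\Delta,\sigma$, if no such pair with precomputation in time $\mathrm{poly}(\lambda,T)$ solves random instances of the family in parallel time $\sigma+1$ on $\max(\Delta,2\lambda+1)$ processors with non-negligible probability, the VDF is $(\Delta,\sigma)$-sequential. -/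

import Mathlib

open Asymptotics Filter

/-- Bit strings of length `n`. -/
abbrev Bits (n : ℕ) : Type := Fin n → Bool

/-- The first `a` bits of a string of length `a + b`. -/
def Bits.left {a b : ℕ} (z : Bits (a + b)) : Bits a := fun j => z (Fin.castAdd b j)

/-- The last `b` bits of a string of length `a + b`. -/
def Bits.right {a b : ℕ} (z : Bits (a + b)) : Bits b := fun j => z (Fin.natAdd a j)

/-- Binary code, of length `n + 1`, of an index `i ≤ 2 ^ n`. -/
def encodeIndex (n i : ℕ) : Bits (n + 1) := fun j => i.testBit j

/-- The number with the given binary digits (least significant bit first). -/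
def decodeIndex {m : ℕ} (b : Bits m) : ℕ := ∑ j : Fin m, (b j).toNat * 2 ^ (j : ℕ)

/-! ### Boolean circuits

The model of non-uniform computation. A circuit is a sequence of layers. In one time step, the
processors of the next layer each read at most two cells of the current layer and write one cell.
So the depth is the parallel time, the width is the number of processors, and the size is the
total work (the sequential running time). -/

/-- A gate that reads from `n` cells. -/
inductive Gate (n : ℕ) : Type
  | const (b : Bool) : Gate n
  | copy (i : Fin n) : Gate n
  | nand (i j : Fin n) : Gate n

def Gate.eval {n : ℕ} : Gate n → Bits n → Bool
  | .const b, _ => b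
  | .copy i, x => x i
  | .nand i j, x => !(x i && x j)

/-- Layered circuits with the given number of inputs and of outputs. -/
inductive Circuit : ℕ → ℕ → Type
  | nil (n : ℕ) : Circuit n n
  | step {n m k : ℕ} (layer : Fin m → Gate n) (rest : Circuit m k) : Circuit n k

namespace Circuit

def eval : {n k : ℕ} → Circuit n k → Bits n → Bits k
  | _, _, .nil _, x => x
  | _, _, .step layer rest, x => rest.eval fun j => (layer j).eval x

/-- Number of layers: the parallel running time. -/
def depth : {n k : ℕ} → Circuit n k → ℕ
  | _, _, .nil _ => 0
  | _, _, .step _ rest => rest.depth + 1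

/-- Largest number of gates in a layer: the number of processors. -/
def width : {n k : ℕ} → Circuit n k → ℕ
  | _, _, .nil _ => 0
  | _, _, .step (m := m) _ rest => max m rest.width

/-- Number of gates: the total running time. -/
def size : {n k : ℕ} → Circuit n k → ℕ
  | _, _, .nil _ => 0
  | _, _, .step (m := m) _ rest => m + rest.size

end Circuit

/-! ### Asymptotics and probability -/

/-- `f(n) ≤ poly(g(n))`. -/
def PolyIn (f g : ℕ → ℕ) : Prop := ∃ c : ℕ, ∀ n, f n ≤ c * (g n + 1) ^ c

/-- Negligible functions: `n ^ (-ω(1))`. -/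
def Negligible (ε : ℕ → ℝ) : Prop := SuperpolynomialDecay atTop (fun n : ℕ => (n : ℝ)) ε

/-- `T ∈ 2 ^ o(n)`. -/
def Subexponential (T : ℕ → ℕ) : Prop :=
  (fun n => Real.logb 2 (T n)) =o[atTop] fun n : ℕ => (n : ℝ)

/-- Probability of an event under the uniform distribution on a finite type. -/
noncomputable def prob {Ω : Type} [Fintype Ω] (P : Ω → Prop) : ℝ :=
  (Nat.card {ω : Ω // P ω} : ℝ) / Fintype.card Ω

/-! ### Relaxed sink of verifiable line -/

/-- An instance `(S, V, T, v₀)` on vertex set `{0,1}^n`. The guarantee is one-sided: `V` accepts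
every vertex of the line at its position, and may also accept other pairs. -/
structure RSVLInstance (n : ℕ) where
  S : Bits n → Bits n
  V : Bits n → ℕ → Bool
  T : ℕ
  source : Bits n
  one_le_T : 1 ≤ T
  T_le : T ≤ 2 ^ n
  accepts_line : ∀ i, 1 ≤ i → i ≤ T → V (S^[i] source) i = true

namespace RSVLInstance

variable {n : ℕ}

/-- `(u, i)` is a false positive: off the line, but accepted. -/
def IsFalsePositive (I : RSVLInstance n) (u : Bits n) (i : ℕ) : Prop :=
  1 ≤ i ∧ i ≤ I.T ∧ u ≠ I.S^[i] I.source ∧ I.V u i = true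

/-- `(u, i)` solves the instance: an accepted vertex at `T`, or a false positive. -/
def IsSolution (I : RSVLInstance n) (u : Bits n) (i : ℕ) : Prop :=
  (i = I.T ∧ I.V u I.T = true) ∨ I.IsFalsePositive u i

/-- The set of false positive vertices. -/
def falsePositives (I : RSVLInstance n) : Set (Bits n) := {u | ∃ i, I.IsFalsePositive u i}

end RSVLInstance

/-- A family of instances `(S, V, v, T(n))`, `v ∈ {0,1}^n`, given by polynomial-size circuits. For
each `n` the sub-families are indexed by keys `key ∈ {0,1}^(keyLen n)`. The circuit `V` reads the
key, the source `v`, a vertex and an index. -/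
structure RSVLFamily (T : ℕ → ℕ) where
  keyLen : ℕ → ℕ
  succCircuit : ∀ n, Circuit (keyLen n + n) n
  verCircuit : ∀ n, Circuit (keyLen n + n + n + (n + 1)) 1
  keyLen_poly : PolyIn keyLen fun n => n
  succ_poly : PolyIn (fun n => (succCircuit n).size) fun n => n
  ver_poly : PolyIn (fun n => (verCircuit n).size) fun n => n
  one_le_T : ∀ n, 1 ≤ T n
  T_le : ∀ n, T n ≤ 2 ^ n
  accepts_line : ∀ n (key : Bits (keyLen n)) (v : Bits n) (i : ℕ), 1 ≤ i → i ≤ T n →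
    (verCircuit n).eval (Fin.append (Fin.append (Fin.append key v)
      ((fun u => (succCircuit n).eval (Fin.append key u))^[i] v)) (encodeIndex n i)) 0 = true

namespace RSVLFamily

variable {T : ℕ → ℕ}

/-- The instance with source `v` in the sub-family given by `key`. -/
def inst (F : RSVLFamily T) {n : ℕ} (key : Bits (F.keyLen n)) (v : Bits n) : RSVLInstance n where
  S u := (F.succCircuit n).eval (Fin.append key u)
  V u i := (F.verCircuit n).eval (Fin.append (Fin.append (Fin.append key v) u)
    (encodeIndex n i)) 0
  T := T n
  source := v
  one_le_T := F.one_le_T n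
  T_le := F.T_le n
  accepts_line := F.accepts_line n key v

/-- Every instance has at most `poly(n)` false positive vertices. -/
def FewFalsePositives (F : RSVLFamily T) : Prop :=
  ∃ c : ℕ, ∀ (n : ℕ) (key : Bits (F.keyLen n)) (v : Bits n),
    (F.inst key v).falsePositives.ncard ≤ c * (n + 1) ^ c

/-- A randomized algorithm that reads the key and its coins and writes the source of an instance,
a vertex and an index. -/
structure Finder (F : RSVLFamily T) (n : ℕ) where
  coins : ℕ
  circuit : Circuit (F.keyLen n + coins) (n + n + (n + 1))

/-- Probability that a finder outputs an instance of a random sub-family together with one of its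
false positives. -/
noncomputable def Finder.advantage {F : RSVLFamily T} {n : ℕ} (B : F.Finder n) : ℝ :=
  prob fun ω : Bits (F.keyLen n) × Bits B.coins =>
    let z := B.circuit.eval (Fin.append ω.1 ω.2)
    (F.inst ω.1 z.left.left).IsFalsePositive z.left.right (decodeIndex z.right)

/-- A parallel solver: `pre` computes a state from the key alone, `main` reads this state and the
source, and writes a vertex and an index. Both are randomized. -/
structure Solver (F : RSVLFamily T) (n : ℕ) where
  preCoins : ℕ
  mainCoins : ℕ
  stateLen : ℕ
  pre : Circuit (F.keyLen n + preCoins) stateLen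
  main : Circuit (stateLen + n + mainCoins) (n + (n + 1))

/-- Probability that a solver solves the instance with random source in a random sub-family. -/
noncomputable def Solver.advantage {F : RSVLFamily T} {n : ℕ} (B : F.Solver n) : ℝ :=
  prob fun ω : Bits (F.keyLen n) × Bits B.preCoins × Bits n × Bits B.mainCoins =>
    let state := B.pre.eval (Fin.append ω.1 ω.2.1)
    let z := B.main.eval (Fin.append (Fin.append state ω.2.2.1) ω.2.2.2)
    (F.inst ω.1 ω.2.2.1).IsSolution z.left (decodeIndex z.right)

/-- No non-uniform algorithm of running time `poly(n, T)` finds false positives. -/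
def FalsePositivesHard (F : RSVLFamily T) : Prop :=
  ∀ B : ∀ n, F.Finder n, PolyIn (fun n => (B n).circuit.size) (fun n => n + T n) →
    Negligible fun n => (B n).advantage

/-- No non-uniform algorithm with precomputation in time `poly(n, T)` solves random instances in
parallel time `σ` on `Δ` processors. -/
def HardToSolve (F : RSVLFamily T) (Δ σ : ℕ → ℕ) : Prop :=
  ∀ B : ∀ n, F.Solver n, PolyIn (fun n => (B n).pre.size) (fun n => n + T n) →
    (∀ n, (B n).main.width ≤ Δ n) → (∀ n, (B n).main.depth ≤ σ n) →
    Negligible fun n => (B n).advantage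

end RSVLFamily

/-! ### Verifiable delay functions -/

/-- The algorithms of a verifiable delay function with public parameters, inputs and outputs of
the given lengths. `Setup` maps its coins to `pp`. `Eval (pp, x) = (y, π)` consists of the
deterministic `eval`, for `y`, and the randomized `prove`, for `π`. `Verify` reads
`(pp, x, y, π)`. -/
structure VDF (ppLen inLen outLen : ℕ → ℕ) where
  setupCoins : ℕ → ℕ
  proveCoins : ℕ → ℕ
  proofLen : ℕ → ℕ
  setup : ∀ n, Circuit (setupCoins n) (ppLen n)
  eval : ∀ n, Circuit (ppLen n + inLen n) (outLen n)
  prove : ∀ n, Circuit (ppLen n + inLen n + proveCoins n) (proofLen n)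
  verify : ∀ n, Circuit (ppLen n + inLen n + outLen n + proofLen n) 1

/-- Permutation verifiable delay functions: the input and the output domain coincide. -/
abbrev PermutationVDF (ppLen len : ℕ → ℕ) := VDF ppLen len len

namespace VDF

variable {ppLen inLen outLen : ℕ → ℕ}

/-- The output `y` of `Eval (pp, x)`. -/
def output (W : VDF ppLen inLen outLen) {n : ℕ} (pp : Bits (ppLen n)) (x : Bits (inLen n)) :
    Bits (outLen n) :=
  (W.eval n).eval (Fin.append pp x)

/-- `Verify (pp, x, y, π)`. -/
def accepts (W : VDF ppLen inLen outLen) {n : ℕ} (pp : Bits (ppLen n)) (x : Bits (inLen n))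
    (y : Bits (outLen n)) (π : Bits (W.proofLen n)) : Bool :=
  (W.verify n).eval (Fin.append (Fin.append (Fin.append pp x) y) π) 0

/-- The running times for the delay parameter `T`: `Setup` and `Verify` run in time
`poly(n, log T)`, and `Eval` takes `T` steps of `unit n` time units each, on `poly(n, log T)`
processors. -/
structure HasDelay (W : VDF ppLen inLen outLen) (T unit : ℕ → ℕ) : Prop where
  setup_poly : PolyIn (fun n => (W.setup n).size) fun n => n + Nat.log 2 (T n)
  eval_depth : ∀ n, (W.eval n).depth ≤ T n * unit n
  prove_depth : ∀ n, (W.prove n).depth ≤ T n * unit n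
  eval_width : PolyIn (fun n => (W.eval n).width) fun n => n + Nat.log 2 (T n)
  prove_width : PolyIn (fun n => (W.prove n).width) fun n => n + Nat.log 2 (T n)
  verify_poly : PolyIn (fun n => (W.verify n).size) fun n => n + Nat.log 2 (T n)

/-- Probability that an honestly computed output and proof for a random input are accepted. -/
noncomputable def acceptProb (W : VDF ppLen inLen outLen) (n : ℕ) : ℝ :=
  prob fun ω : Bits (W.setupCoins n) × Bits (inLen n) × Bits (W.proveCoins n) =>
    let pp := (W.setup n).eval ω.1
    W.accepts pp ω.2.1 (W.output pp ω.2.1)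
      ((W.prove n).eval (Fin.append (Fin.append pp ω.2.1) ω.2.2)) = true

def IsCorrect (W : VDF ppLen inLen outLen) : Prop :=
  ∃ ε : ℕ → ℝ, Negligible ε ∧ ∀ n, 1 - ε n ≤ W.acceptProb n

/-- A randomized algorithm that reads `pp` and writes `(x, y, π)`. -/
structure SoundnessAdversary (W : VDF ppLen inLen outLen) (n : ℕ) where
  coins : ℕ
  circuit : Circuit (ppLen n + coins) (inLen n + outLen n + W.proofLen n)

/-- Probability of writing an accepted triple `(x, y, π)` with `y ≠ Eval (pp, x)`. -/
noncomputable def SoundnessAdversary.advantage {W : VDF ppLen inLen outLen} {n : ℕ}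
    (A : W.SoundnessAdversary n) : ℝ :=
  prob fun ω : Bits (W.setupCoins n) × Bits A.coins =>
    let pp := (W.setup n).eval ω.1
    let z := A.circuit.eval (Fin.append pp ω.2)
    z.left.right ≠ W.output pp z.left.left ∧
      W.accepts pp z.left.left z.left.right z.right = true

/-- Computational soundness against non-uniform algorithms of running time `poly(n, T)`. -/
def IsSound (W : VDF ppLen inLen outLen) (T : ℕ → ℕ) : Prop :=
  ∀ A : ∀ n, W.SoundnessAdversary n, PolyIn (fun n => (A n).circuit.size) (fun n => n + T n) →
    Negligible fun n => (A n).advantage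

/-- A parallel adversary: `pre` computes a state from `pp` alone, `main` reads this state and the
input, and writes an output. Both are randomized. -/
structure ParallelAdversary (W : VDF ppLen inLen outLen) (n : ℕ) where
  preCoins : ℕ
  mainCoins : ℕ
  stateLen : ℕ
  pre : Circuit (ppLen n + preCoins) stateLen
  main : Circuit (stateLen + inLen n + mainCoins) (outLen n)

/-- Probability of computing the output for a random input. -/
noncomputable def ParallelAdversary.advantage {W : VDF ppLen inLen outLen} {n : ℕ}
    (A : W.ParallelAdversary n) : ℝ :=
  prob fun ω : Bits (W.setupCoins n) × Bits A.preCoins × Bits (inLen n) × Bits A.mainCoins =>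
    let pp := (W.setup n).eval ω.1
    let state := A.pre.eval (Fin.append pp ω.2.1)
    A.main.eval (Fin.append (Fin.append state ω.2.2.1) ω.2.2.2) = W.output pp ω.2.2.1

/-- `(Δ, σ)`-sequentiality: after precomputation in time `poly(n, T)`, the output for a random
input is not computed in parallel time `σ` on `Δ` processors. -/
def IsSequential (W : VDF ppLen inLen outLen) (T Δ σ : ℕ → ℕ) : Prop :=
  ∀ A : ∀ n, W.ParallelAdversary n, PolyIn (fun n => (A n).pre.size) (fun n => n + T n) →
    (∀ n, (A n).main.width ≤ Δ n) → (∀ n, (A n).main.depth ≤ σ n) →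
    Negligible fun n => (A n).advantage

end VDF

/-! The input is taken as the source of a line: `Eval` walks `T` steps of `S`, `Verify` is `V` at
position `T`. Honest outputs lie on the line, so they are always accepted. A wrong accepted output
is by definition a false positive at position `T` (`wrong_output_iff`). Hence a soundness adversary
is a finder of false positives, and a random `y` is wrong and accepted with probability at most
`poly(n) / 2 ^ n`. A correct output is accepted at `T`, so it solves the instance
(`advantage_le_toSolver`). Both reductions only append the binary code of `T`, in one layer of
constants and copies. The rest is circuit engineering: iterating `S` must keep the key available
without spending additional layers on it (`keep`, `iterateKeyed`). -/

/-! ### Operations on circuits -/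

namespace Circuit

/-- Run one circuit after the other. -/
def comp : {n m k : ℕ} → Circuit n m → Circuit m k → Circuit n k
  | _, _, _, .nil _, D => D
  | _, _, _, .step layer rest, D => .step layer (rest.comp D)

theorem eval_comp {n m k : ℕ} (C : Circuit n m) (D : Circuit m k) (x : Bits n) :
    (C.comp D).eval x = D.eval (C.eval x) := by
  induction C with
  | nil => rfl
  | step layer rest ih => exact ih D _

theorem depth_comp {n m k : ℕ} (C : Circuit n m) (D : Circuit m k) :
    (C.comp D).depth = C.depth + D.depth := by
  induction C with
  | nil => simp [comp, depth]
  | step layer rest ih => simp only [comp, depth, ih]; omega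

theorem width_comp {n m k : ℕ} (C : Circuit n m) (D : Circuit m k) :
    (C.comp D).width = max C.width D.width := by
  induction C with
  | nil => simp [comp, width]
  | step layer rest ih => simp only [comp, width, ih, max_assoc]

theorem size_comp {n m k : ℕ} (C : Circuit n m) (D : Circuit m k) :
    (C.comp D).size = C.size + D.size := by
  induction C with
  | nil => simp [comp, size]
  | step layer rest ih => simp only [comp, size, ih]; omega

theorem width_le_size {n m : ℕ} (C : Circuit n m) : C.width ≤ C.size := by
  induction C with
  | nil => exact le_rfl
  | step layer rest ih => simp only [width, size]; omega

/-- The circuit with a single layer. -/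
def single {n m : ℕ} (layer : Fin m → Gate n) : Circuit n m := .step layer (.nil m)

/-- One layer that copies its input and appends a constant string. -/
def appendConst (n : ℕ) {m : ℕ} (b : Bits m) : Circuit n (n + m) :=
  single (Fin.append (fun i => Gate.copy i) fun j => Gate.const (b j))

theorem eval_appendConst {n m : ℕ} (b : Bits m) (x : Bits n) :
    (appendConst n b).eval x = Fin.append x b := by
  funext j
  refine Fin.addCases (fun i => ?_) (fun i => ?_) j <;>
    simp [appendConst, single, eval, Gate.eval]

@[simp] theorem depth_appendConst (n : ℕ) {m : ℕ} (b : Bits m) :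
    (appendConst n b).depth = 1 := rfl

@[simp] theorem width_appendConst (n : ℕ) {m : ℕ} (b : Bits m) :
    (appendConst n b).width = n + m := by simp [appendConst, single, width]

@[simp] theorem size_appendConst (n : ℕ) {m : ℕ} (b : Bits m) :
    (appendConst n b).size = n + m := by simp [appendConst, single, size]

/-- A gate that ignores the first `a` cells. -/
def _root_.Gate.shift (a : ℕ) {n : ℕ} : Gate n → Gate (a + n)
  | .const b => .const b
  | .copy i => .copy (Fin.natAdd a i)
  | .nand i j => .nand (Fin.natAdd a i) (Fin.natAdd a j)

theorem _root_.Gate.eval_shift {a n : ℕ} (g : Gate n) (k : Bits a) (x : Bits n) :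
    (g.shift a).eval (Fin.append k x) = g.eval x := by
  cases g <;> simp [Gate.shift, Gate.eval]

/-- Run a circuit next to `a` cells that are passed on unchanged. -/
def carry (a : ℕ) : {n m : ℕ} → Circuit n m → Circuit (a + n) (a + m)
  | _, _, .nil n => .nil (a + n)
  | _, _, .step layer rest =>
    .step (Fin.append (fun i => Gate.copy (Fin.castAdd _ i)) fun j => (layer j).shift a)
      (rest.carry a)

theorem eval_carry {a n m : ℕ} (C : Circuit n m) (k : Bits a) (x : Bits n) :
    (C.carry a).eval (Fin.append k x) = Fin.append k (C.eval x) := by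
  induction C with
  | nil => rfl
  | step layer rest ih =>
    simp only [carry, eval]
    rw [← ih]
    congr 1
    funext j
    refine Fin.addCases (fun i => ?_) (fun i => ?_) j
    · simp [Gate.eval]
    · simp [Gate.eval_shift]

theorem depth_carry (a : ℕ) {n m : ℕ} (C : Circuit n m) : (C.carry a).depth = C.depth := by
  induction C with
  | nil => rfl
  | step layer rest ih => simp only [carry, depth, ih]

theorem width_carry_le (a : ℕ) {n m : ℕ} (C : Circuit n m) :
    (C.carry a).width ≤ a + C.width := by
  induction C with
  | nil => simp [carry, width]
  | step layer rest ih => simp only [carry, width]; omega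

/-- Run a circuit, and write a copy of the `a` selected input cells in front of its output. -/
def keep {a : ℕ} : {n m : ℕ} → (Fin a → Fin n) → Circuit n m → Circuit n (a + m)
  | _, _, sel, .nil _ => single (Fin.append (fun i => Gate.copy (sel i)) fun j => Gate.copy j)
  | _, _, sel, .step layer rest =>
    .step (Fin.append (fun i => Gate.copy (sel i)) layer) (rest.carry a)

theorem eval_keep {a n m : ℕ} (sel : Fin a → Fin n) (C : Circuit n m) (x : Bits n) :
    (C.keep sel).eval x = Fin.append (fun i => x (sel i)) (C.eval x) := by
  cases C with
  | nil =>
    funext j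
    refine Fin.addCases (fun i => ?_) (fun i => ?_) j <;>
      simp [keep, single, eval, Gate.eval]
  | step layer rest =>
    simp only [keep, eval]
    rw [← eval_carry]
    congr 1
    funext j
    refine Fin.addCases (fun i => ?_) (fun i => ?_) j <;> simp [Gate.eval]

/-- The copies are made inside the first layer of `C` and then carried alongside, at no cost in
depth. Only the empty circuit has no layer to put them in, whence the maximum with `1`, which is
also the time unit of the theorem. -/
theorem depth_keep {a n m : ℕ} (sel : Fin a → Fin n) (C : Circuit n m) :
    (C.keep sel).depth = max 1 C.depth := by
  cases C with
  | nil => rfl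
  | step layer rest => simp only [keep, depth, depth_carry]; omega

theorem width_keep_le {a n m : ℕ} (sel : Fin a → Fin n) (C : Circuit n m) :
    (C.keep sel).width ≤ a + n + C.width := by
  cases C with
  | nil => simp [keep, single, width]
  -- The summand `n` in the bound is needed only for the empty circuit, whose width is `0`.
  | step layer rest =>
    have := width_carry_le a rest
    simp only [keep, width]
    omega

/-- Iterate `t + 1` times, with a fixed key, a circuit that reads the key and a string. -/
def iterateKeyed {a n : ℕ} (C : Circuit (a + n) n) : ℕ → Circuit (a + n) n
  | 0 => C
  | t + 1 => (C.keep (Fin.castAdd n)).comp (C.iterateKeyed t)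

/-- The count is `t + 1` because the last round is `C` itself, without `keep`, which drops the key.
-/
theorem eval_iterateKeyed {a n : ℕ} (C : Circuit (a + n) n) (t : ℕ) (k : Bits a) (x : Bits n) :
    (C.iterateKeyed t).eval (Fin.append k x) = (fun u => C.eval (Fin.append k u))^[t + 1] x := by
  induction t generalizing x with
  | zero => rfl
  | succ t ih =>
    rw [iterateKeyed, eval_comp, eval_keep, Function.iterate_succ_apply, ← ih]
    simp

theorem depth_iterateKeyed_le {a n : ℕ} (C : Circuit (a + n) n) (t : ℕ) :
    (C.iterateKeyed t).depth ≤ (t + 1) * max 1 C.depth := by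
  induction t with
  | zero => simp [iterateKeyed]
  | succ t ih =>
    rw [iterateKeyed, depth_comp, depth_keep, add_mul (t + 1), one_mul]
    omega

theorem width_iterateKeyed_le {a n : ℕ} (C : Circuit (a + n) n) (t : ℕ) :
    (C.iterateKeyed t).width ≤ a + (a + n) + C.width := by
  induction t with
  | zero => simp [iterateKeyed]
  | succ t ih =>
    rw [iterateKeyed, width_comp]
    exact max_le (width_keep_le _ _) ih

end Circuit

/-! ### Binary codes of indices -/

theorem decodeIndex_testBit (m i : ℕ) :
    decodeIndex (fun j : Fin m => i.testBit j) = i % 2 ^ m := by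
  induction m with
  | zero => simp [decodeIndex, Nat.mod_one]
  | succ m ih =>
    rw [decodeIndex] at ih ⊢
    -- Split off the most significant digit, which is `i / 2 ^ m` modulo `2`.
    rw [Fin.sum_univ_castSucc]
    simp only [Fin.val_castSucc, Fin.val_last] at ih ⊢
    rw [ih, Nat.mod_pow_succ, Nat.testBit_eq_decide_div_mod_eq, mul_comm]
    rcases Nat.mod_two_eq_zero_or_one (i / 2 ^ m) with h | h <;> simp [h]

/-- The code has `n + 1` bits because the value `2 ^ n` is allowed. -/
theorem decodeIndex_encodeIndex {n i : ℕ} (hi : i ≤ 2 ^ n) : decodeIndex (encodeIndex n i) = i := by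
  refine (decodeIndex_testBit (n + 1) i).trans (Nat.mod_eq_of_lt ?_)
  exact hi.trans_lt (Nat.pow_lt_pow_right one_lt_two n.lt_succ_self)

namespace Bits

@[simp] theorem left_append {a b : ℕ} (x : Bits a) (y : Bits b) : left (Fin.append x y) = x := by
  funext j; simp [left]

@[simp] theorem right_append {a b : ℕ} (x : Bits a) (y : Bits b) : right (Fin.append x y) = y := by
  funext j; simp [right]

theorem append_zero {a : ℕ} (x : Bits a) (y : Bits 0) : Fin.append x y = x :=
  Fin.append_right_nil x y rfl

end Bits

/-! ### Polynomial bounds, probabilities and negligible functions -/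

namespace PolyIn

variable {f f' g g' : ℕ → ℕ}

theorem mono (hf : PolyIn f g) (h : ∀ n, f' n ≤ f n) : PolyIn f' g :=
  let ⟨c, hc⟩ := hf
  ⟨c, fun n => (h n).trans (hc n)⟩

theorem mono_right (hf : PolyIn f g) (h : ∀ n, g n ≤ g' n) : PolyIn f g' :=
  let ⟨c, hc⟩ := hf
  ⟨c, fun n => (hc n).trans (by gcongr; exact h n)⟩

theorem add (hf : PolyIn f g) (hf' : PolyIn f' g) : PolyIn (fun n => f n + f' n) g := by
  obtain ⟨c, hc⟩ := hf
  obtain ⟨d, hd⟩ := hf'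
  -- One constant is both factor and exponent; raising the exponent is harmless as the base is at
  -- least `1`.
  refine ⟨c + d, fun n => (add_le_add (hc n) (hd n)).trans ?_⟩
  rw [add_mul]
  gcongr <;> omega

theorem self (g : ℕ → ℕ) : PolyIn g g := ⟨1, fun n => by simp⟩

theorem const (c : ℕ) (g : ℕ → ℕ) : PolyIn (fun _ => c) g :=
  ⟨c, fun n => Nat.le_mul_of_pos_right _ (by positivity)⟩

end PolyIn

section Prob

variable {Ω : Type} [Fintype Ω] {P Q : Ω → Prop}

theorem prob_nonneg (P : Ω → Prop) : 0 ≤ prob P := by unfold prob; positivity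

theorem prob_mono (h : ∀ ω, P ω → Q ω) : prob P ≤ prob Q := by
  unfold prob
  gcongr
  exact Nat.card_le_card_of_injective _ (Subtype.map_injective h Function.injective_id)

theorem prob_congr (h : ∀ ω, P ω ↔ Q ω) : prob P = prob Q :=
  congrArg prob (funext fun ω => propext (h ω))

theorem prob_eq_one [Nonempty Ω] (h : ∀ ω, P ω) : prob P = 1 := by
  rw [prob_congr (Q := fun _ => True) fun ω => by simp [h ω]]
  simp [prob]

theorem prob_eq_const (a : Ω) : prob (fun ω => ω = a) = 1 / Fintype.card Ω := by
  simp [prob]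

theorem prob_le_ncard_div (s : Set Ω) (h : ∀ ω, P ω → ω ∈ s) :
    prob P ≤ s.ncard / Fintype.card Ω := by
  refine (prob_mono (Q := (· ∈ s)) h).trans_eq ?_
  rfl

end Prob

namespace Negligible

variable {ε δ : ℕ → ℝ}

theorem mono (hδ : Negligible δ) (h0 : ∀ n, 0 ≤ ε n) (h : ∀ n, ε n ≤ δ n) : Negligible ε :=
  SuperpolynomialDecay.trans_abs_le hδ fun n => by
    rw [abs_of_nonneg (h0 n)]
    exact (h n).trans (le_abs_self _)

theorem zero : Negligible fun _ => 0 := superpolynomialDecay_zero _ _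

/-- This is the density of polynomially many false positives in `{0,1}^n`: superpolynomial decay of
`(1 / 2) ^ n` survives a polynomial factor. -/
theorem const_mul_pow_div_two_pow (c : ℕ) :
    Negligible fun n => ((c * (n + 1) ^ c : ℕ) : ℝ) / 2 ^ n := by
  have key : Negligible fun n => (1 / 2 : ℝ) ^ n := fun k =>
    tendsto_pow_const_mul_const_pow_of_lt_one k (by norm_num) (by norm_num)
  have := SuperpolynomialDecay.polynomial_mul key
    (Polynomial.C (c : ℝ) * (Polynomial.X + 1) ^ c)
  refine this.congr fun n => ?_
  simp [div_eq_mul_inv]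

end Negligible

/-! ### The verifiable delay function of a family of instances -/

namespace RSVLFamily

variable {T : ℕ → ℕ} (F : RSVLFamily T)

/-- The verifiable delay function whose public parameters are a random key, with evaluation
`x ↦ S^T (x)`, an empty proof, and the verifier of the instance with source `x` at position `T`. -/
def toVDF : PermutationVDF F.keyLen fun n => n where
  setupCoins := F.keyLen
  proveCoins _ := 0
  proofLen _ := 0
  setup n := .nil (F.keyLen n)
  -- `iterateKeyed t` makes `t + 1` rounds, and `1 ≤ T n`.
  eval n := (F.succCircuit n).iterateKeyed (T n - 1)
  -- A layer without gates discards the input. It counts as depth `1`, within the allowed delay.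
  prove _ := .single Fin.elim0
  verify n := (Circuit.appendConst _ (encodeIndex n (T n))).comp (F.verCircuit n)

theorem output_toVDF {n : ℕ} (pp : Bits (F.keyLen n)) (x : Bits n) :
    F.toVDF.output pp x = (F.inst pp x).S^[T n] x := by
  refine (Circuit.eval_iterateKeyed _ _ _ _).trans ?_
  rw [Nat.sub_add_cancel (F.one_le_T n)]
  rfl

theorem accepts_toVDF {n : ℕ} (pp : Bits (F.keyLen n)) (x y : Bits n) (π : Bits 0) :
    F.toVDF.accepts pp x y π = (F.inst pp x).V y (T n) := by
  refine congrFun ((Circuit.eval_comp (Circuit.appendConst _ (encodeIndex n (T n)))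
    (F.verCircuit n) _).trans (congrArg (F.verCircuit n).eval ?_)) 0
  refine (Circuit.eval_appendConst _ _).trans (congrArg (Fin.append · _) ?_)
  exact Bits.append_zero _ _

theorem accepts_output_toVDF {n : ℕ} (pp : Bits (F.keyLen n)) (x : Bits n) (π : Bits 0) :
    F.toVDF.accepts pp x (F.toVDF.output pp x) π = true := by
  rw [accepts_toVDF, output_toVDF]
  exact F.accepts_line n pp x (T n) (F.one_le_T n) le_rfl

/-- Wrong accepted outputs are the false positives at position `T`. -/
theorem wrong_output_iff {n : ℕ} (pp : Bits (F.keyLen n)) (x y : Bits n) (π : Bits 0) :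
    (y ≠ F.toVDF.output pp x ∧ F.toVDF.accepts pp x y π = true) ↔
      (F.inst pp x).IsFalsePositive y (T n) := by
  rw [accepts_toVDF, output_toVDF]
  exact ⟨fun h => ⟨F.one_le_T n, le_rfl, h⟩, fun h => h.2.2⟩

theorem hasDelay_toVDF : F.toVDF.HasDelay T fun n => max 1 (F.succCircuit n).depth := by
  have le_log : ∀ n, n ≤ n + Nat.log 2 (T n) := fun n => Nat.le_add_right _ _
  have key := F.keyLen_poly.mono_right le_log
  have len := (PolyIn.self fun n => n).mono_right le_log
  refine ⟨?_, fun n => ?_, fun n => ?_, ?_, ?_, ?_⟩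
  · exact PolyIn.const 0 _
  · refine (Circuit.depth_iterateKeyed_le _ _).trans_eq ?_
    rw [Nat.sub_add_cancel (F.one_le_T n)]
  · exact Nat.mul_pos (F.one_le_T n) (by omega)
  · refine ((key.add (key.add len)).add (F.succ_poly.mono_right le_log)).mono fun n => ?_
    exact (Circuit.width_iterateKeyed_le _ _).trans
      (Nat.add_le_add_left (Circuit.width_le_size _) _)
  · exact PolyIn.const 0 _
  -- The layer that appends `T` copies the key, `x` and `y` and writes `n + 1` constants.
  · refine ((((key.add len).add len).add (len.add (PolyIn.const 1 _))).add
      (F.ver_poly.mono_right le_log)).mono fun n => ?_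
    exact ((Circuit.size_comp _ _).trans
      (congrArg (· + _) (Circuit.size_appendConst _ (encodeIndex n (T n))))).le

theorem isCorrect_toVDF : F.toVDF.IsCorrect := by
  refine ⟨fun _ => 0, Negligible.zero, fun n => ?_⟩
  rw [sub_zero]
  refine (prob_eq_one fun ω => ?_).ge
  exact F.accepts_output_toVDF _ _ _

/-- The bound is free of `pp` and `x`, so a single negligible function serves for all of them. -/
theorem prob_wrong_output_le {c : ℕ}
    (hc : ∀ (n : ℕ) (key : Bits (F.keyLen n)) (v : Bits n),
      (F.inst key v).falsePositives.ncard ≤ c * (n + 1) ^ c)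
    {n : ℕ} (pp : Bits (F.keyLen n)) (x : Bits n) (π : Bits 0) :
    prob (fun y : Bits n => y ≠ F.toVDF.output pp x ∧ F.toVDF.accepts pp x y π = true) ≤
      ((c * (n + 1) ^ c : ℕ) : ℝ) / 2 ^ n := by
  refine (prob_le_ncard_div (F.inst pp x).falsePositives fun y hy =>
    ⟨T n, (F.wrong_output_iff pp x y π).1 hy⟩).trans ?_
  simp only [Fintype.card_fun, Fintype.card_fin, Fintype.card_bool, Nat.cast_pow, Nat.cast_ofNat]
  gcongr
  exact_mod_cast hc n pp x

/-- Output the input and the output written by an adversary against soundness, as a source and a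
vertex at position `T`. -/
def toFinder {n : ℕ} (A : F.toVDF.SoundnessAdversary n) : F.Finder n where
  coins := A.coins
  circuit := A.circuit.comp (Circuit.appendConst (n + n) (encodeIndex n (T n)))

theorem size_toFinder {n : ℕ} (A : F.toVDF.SoundnessAdversary n) :
    (F.toFinder A).circuit.size = A.circuit.size + (3 * n + 1) := by
  refine (Circuit.size_comp _ _).trans (congrArg (_ + ·) ?_)
  exact (Circuit.size_appendConst (n + n) _).trans (by omega)

theorem depth_toFinder {n : ℕ} (A : F.toVDF.SoundnessAdversary n) :
    (F.toFinder A).circuit.depth = A.circuit.depth + 1 :=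
  Circuit.depth_comp _ _

theorem isFalsePositive_append_encodeIndex {n : ℕ} (key : Bits (F.keyLen n))
    {z : Bits (n + n + (n + 1))} {w : Bits (n + n)} (hz : z = Fin.append w (encodeIndex n (T n))) :
    (F.inst key z.left.left).IsFalsePositive z.left.right (decodeIndex z.right) ↔
      (F.inst key w.left).IsFalsePositive w.right (T n) := by
  rw [hz, Bits.left_append, Bits.right_append, decodeIndex_encodeIndex (F.T_le n)]

theorem advantage_toFinder {n : ℕ} (A : F.toVDF.SoundnessAdversary n) :
    (F.toFinder A).advantage = A.advantage := by
  refine prob_congr fun ω => ?_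
  have hz : (F.toFinder A).circuit.eval (Fin.append ω.1 ω.2) =
      Fin.append (A.circuit.eval (Fin.append ω.1 ω.2)) (encodeIndex n (T n)) :=
    (Circuit.eval_comp _ _ _).trans (Circuit.eval_appendConst _ _)
  -- `Setup` is the identity, so both experiments share their sample space and the events agree
  -- pointwise.
  exact (F.isFalsePositive_append_encodeIndex ω.1 hz).trans (F.wrong_output_iff _ _ _ _).symm

/-- Output the string written by a parallel adversary as a vertex at position `T`. -/
def toSolver {n : ℕ} (A : F.toVDF.ParallelAdversary n) : F.Solver n where
  preCoins := A.preCoins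
  mainCoins := A.mainCoins
  stateLen := A.stateLen
  pre := A.pre
  main := A.main.comp (Circuit.appendConst n (encodeIndex n (T n)))

theorem depth_toSolver {n : ℕ} (A : F.toVDF.ParallelAdversary n) :
    (F.toSolver A).main.depth = A.main.depth + 1 :=
  Circuit.depth_comp _ _

theorem width_toSolver {n : ℕ} (A : F.toVDF.ParallelAdversary n) :
    (F.toSolver A).main.width = max A.main.width (2 * n + 1) := by
  refine (Circuit.width_comp _ _).trans (congrArg (max _) ?_)
  exact (Circuit.width_appendConst n _).trans (by omega)

/-- Only an inequality: the solver also wins when the adversary's string is wrong but accepted. -/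
theorem advantage_le_toSolver {n : ℕ} (A : F.toVDF.ParallelAdversary n) :
    A.advantage ≤ (F.toSolver A).advantage := by
  refine prob_mono fun ω hω => ?_
  have hz : (F.toSolver A).main.eval (Fin.append (Fin.append
        ((F.toSolver A).pre.eval (Fin.append ω.1 ω.2.1)) ω.2.2.1) ω.2.2.2) =
      Fin.append (F.toVDF.output ω.1 ω.2.2.1) (encodeIndex n (T n)) :=
    (Circuit.eval_comp _ _ _).trans
      ((Circuit.eval_appendConst _ _).trans (congrArg (Fin.append · _) hω))
  dsimp only
  rw [hz, Bits.left_append, Bits.right_append, decodeIndex_encodeIndex (F.T_le n)]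
  refine Or.inl ⟨rfl, ?_⟩
  exact (F.accepts_toVDF _ _ _ Fin.elim0).symm.trans (F.accepts_output_toVDF _ _ _)

theorem isSound_toVDF (h : F.FalsePositivesHard) : F.toVDF.IsSound T := by
  intro A hA
  have len := (PolyIn.self fun n => n).mono_right fun n => Nat.le_add_right n (T n)
  have := h (fun n => F.toFinder (A n)) <|
    (hA.add ((len.add (len.add len)).add (PolyIn.const 1 _))).mono fun n => by
      rw [size_toFinder]
      omega
  simpa only [advantage_toFinder] using this

theorem isSequential_toVDF {Δ σ : ℕ → ℕ}
    (h : F.HardToSolve (fun n => max (Δ n) (2 * n + 1)) fun n => σ n + 1) :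
    F.toVDF.IsSequential T Δ σ := by
  intro A hpre hw hd
  refine (h (fun n => F.toSolver (A n)) hpre (fun n => ?_) fun n => ?_).mono
    (fun n => prob_nonneg _) fun n => F.advantage_le_toSolver (A n)
  · rw [width_toSolver]
    exact max_le_max_right _ (hw n)
  · rw [depth_toSolver]
    exact Nat.succ_le_succ (hd n)

end RSVLFamily

theorem mainTheorem2 (T : ℕ → ℕ) (hT : Subexponential T) (F : RSVLFamily T)
    (hF : F.FewFalsePositives) :
    ∃ W : PermutationVDF F.keyLen (fun n => n),
      -- `Setup` samples a sub-family uniformly at random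
      (∀ (n : ℕ) (pp : Bits (F.keyLen n)),
        prob (fun r : Bits (W.setupCoins n) => (W.setup n).eval r = pp) = 1 / 2 ^ F.keyLen n) ∧
      -- `Eval (pp, x) = S^T (x)`, with an empty proof
      (∀ (n : ℕ) (pp : Bits (F.keyLen n)) (x : Bits n),
        W.output pp x = (F.inst pp x).S^[T n] x) ∧
      (∀ n, W.proofLen n = 0) ∧
      -- `Verify (pp, x, y) = V (y, T)`, for the instance with source `x`
      (∀ (n : ℕ) (pp : Bits (F.keyLen n)) (x y : Bits n) (π : Bits (W.proofLen n)),
        W.accepts pp x y π = (F.inst pp x).V y (T n)) ∧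
      -- delay `T`, where the time unit is that of one evaluation of `S`
      W.HasDelay T (fun n => max 1 (F.succCircuit n).depth) ∧
      -- correctness, even perfect
      W.IsCorrect ∧
      (∀ (n : ℕ) (pp : Bits (F.keyLen n)) (x : Bits n) (π : Bits (W.proofLen n)),
        W.accepts pp x (W.output pp x) π = true) ∧
      -- a random wrong output is accepted with negligible probability
      (∃ ε : ℕ → ℝ, Negligible ε ∧
        ∀ (n : ℕ) (pp : Bits (F.keyLen n)) (x : Bits n) (π : Bits (W.proofLen n)),
          prob (fun y : Bits n => y ≠ W.output pp x ∧ W.accepts pp x y π = true) ≤ ε n) ∧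
      -- soundness: breaking it is finding false positives, with the same probability
      (∀ (n : ℕ) (A : W.SoundnessAdversary n), ∃ B : F.Finder n,
        B.circuit.size ≤ A.circuit.size + (3 * n + 1) ∧
        B.circuit.depth ≤ A.circuit.depth + 1 ∧
        B.advantage = A.advantage) ∧
      (F.FalsePositivesHard → W.IsSound T) ∧
      -- sequentiality: breaking it in parallel time `t` solves instances in time `t + 1`
      (∀ (n : ℕ) (A : W.ParallelAdversary n), ∃ B : F.Solver n,
        B.pre.size ≤ A.pre.size ∧
        B.main.depth ≤ A.main.depth + 1 ∧
        B.main.width ≤ max A.main.width (2 * n + 1) ∧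
        A.advantage ≤ B.advantage) ∧
      (∀ Δ σ : ℕ → ℕ,
        F.HardToSolve (fun n => max (Δ n) (2 * n + 1)) (fun n => σ n + 1) →
          W.IsSequential T Δ σ) := by
  obtain ⟨c, hc⟩ := hF
  refine ⟨F.toVDF, fun n pp => ?_, fun n => F.output_toVDF, fun _ => rfl,
    fun n => F.accepts_toVDF, F.hasDelay_toVDF, F.isCorrect_toVDF,
    fun n => F.accepts_output_toVDF,
    ⟨_, Negligible.const_mul_pow_div_two_pow c, fun n => F.prob_wrong_output_le hc⟩,
    fun n A => ⟨F.toFinder A, (F.size_toFinder A).le, (F.depth_toFinder A).le,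
      F.advantage_toFinder A⟩,
    F.isSound_toVDF,
    fun n A => ⟨F.toSolver A, le_rfl, (F.depth_toSolver A).le, (F.width_toSolver A).le,
      F.advantage_le_toSolver A⟩,
    fun Δ σ => F.isSequential_toVDF⟩
  -- The coins of `Setup` are the key, so the event is a single point.
  refine (prob_eq_const pp).trans ?_
  simp
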